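/- Let $(k,|\cdot|)$ be an algebraically closed field of characteristic $0$, complete with respect to an ultrametric absolute value, whose residue field has characteristic $p>0$. Let $\mathbb{A}^{1,\mathrm{an}}_k$ be the Berkovich affine line over $k$, with coordinate $T$: its points are the multiplicative seminorms on $k[T]$ extending the absolute value of $k$, and for such a point $x$ let $\mathscr{H}(x)$ be the completed residue field (the completion of the fraction field of $k[T]/\{f : |f|_x=0\}$) and $T(x)\in\mathscr{H}(x)$ the image of $T$. For $r>0$ let $x_{0,r}$ be the point $\left|\sum_i a_iT^i\right|_{x_{0,r}}=\max_i|a_i|r^i$. Put $S=T(x_{0,r})$ and let $S\frac{d}{dS}$ be the continuous $k$-derivation of $\mathscr{H}(x_{0,r})$ sending $S$ to $S$; it is an element of the $k$-Banach algebra $\mathcal{L}_k(\mathscr{H}(x_{0,r}))$ of bounded $k$-linear operators with the operator norm. For an element $f$ of a $k$-Banach algebra $E$, the (Berkovich) spectrum $\Sigma_{f,k}(E)$ is the set of points $x\in\mathbb{A}^{1,\mathrm{an}}_k$ such that $f\otimes 1-1\otimes T(x)$ is not invertible in $E\,\widehat{\otimes}_k\,\mathscr{H}(x)$, where $\widehat{\otimes}_k$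 is the completion of the tensor product for the ultrametric tensor seminorm $\|z\|=\inf\max_i\|a_i\|\|b_i\|$ over representations $z=\sum_i a_i\otimes b_i$. Proposition. There is exactly one continuous ring homomorphism $\iota:\mathbb{Z}_p\to k$; regard $\mathbb{Z}_p$ through it as a set of $k$-rational points of $\mathbb{A}^{1,\mathrm{an}}_k$, an element $a\in k$ being identified with the point $f\mapsto|f(a)|$. Then, for every real $r>0$, $$\Sigma_{S\frac{d}{dS},k}\bigl(\mathcal{L}_k(\mathscr{H}(x_{0,r}))\bigr)=\mathbb{Z}_p .$$ -/

import Mathlib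

open Polynomial
open scoped TensorProduct

noncomputable section

/-! ## The completed tensor product of ultrametric Banach algebras -/

/-- The tensor product `E ⊗[k] L` as a type of its own, carrying the ultrametric tensor seminorm. -/
def UTensor (k E L : Type*) [CommRing k] [Ring E] [Ring L] [Algebra k E] [Algebra k L] : Type _ :=
  E ⊗[k] L

namespace UTensor

section Seminorm

variable (k : Type*) {E L : Type*} [NormedField k] [NormedRing E] [NormedAlgebra k E]
  [NormedRing L] [NormedAlgebra k L]

/-- The bounds `C` such that `z = ∑ aᵢ ⊗ bᵢ` for some finite family with
`‖aᵢ‖ * ‖bᵢ‖ ≤ C` for all `i`. -/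
def bounds (z : E ⊗[k] L) : Set ℝ :=
  {C | 0 ≤ C ∧ ∃ l : List (E × L), (l.map fun q => q.1 ⊗ₜ[k] q.2).sum = z ∧
    ∀ q ∈ l, ‖q.1‖ * ‖q.2‖ ≤ C}

lemma bounds_nonempty (z : E ⊗[k] L) : (bounds k z).Nonempty := by
  induction z using TensorProduct.induction_on with
  | zero => exact ⟨0, le_rfl, [], by simp, by simp⟩
  | tmul a b => exact ⟨‖a‖ * ‖b‖, by positivity, [(a, b)], by simp, by simp⟩
  | add z w hz hw =>
    obtain ⟨C, hC, l, hl, hlC⟩ := hz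
    obtain ⟨C', hC', l', hl', hlC'⟩ := hw
    refine ⟨max C C', le_max_of_le_left hC, l ++ l', by simp [hl, hl'], fun q hq => ?_⟩
    rcases List.mem_append.1 hq with h | h
    · exact (hlC q h).trans (le_max_left _ _)
    · exact (hlC' q h).trans (le_max_right _ _)

lemma bounds_bddBelow (z : E ⊗[k] L) : BddBelow (bounds k z) := ⟨0, fun _ h => h.1⟩

/-- The ultrametric tensor seminorm `‖z‖ = inf max ‖aᵢ‖ * ‖bᵢ‖`, the infimum being over all
representations `z = ∑ aᵢ ⊗ bᵢ` as a finite sum. -/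
def tnorm (z : E ⊗[k] L) : ℝ := sInf (bounds k z)

lemma tnorm_nonneg (z : E ⊗[k] L) : 0 ≤ tnorm k z := Real.sInf_nonneg fun _ h => h.1

lemma tnorm_zero : tnorm k (0 : E ⊗[k] L) = 0 :=
  le_antisymm (csInf_le (bounds_bddBelow k _) ⟨le_rfl, [], by simp, by simp⟩) (tnorm_nonneg k _)

lemma exists_lt (z : E ⊗[k] L) {ε : ℝ} (hε : 0 < ε) : ∃ C ∈ bounds k z, C < tnorm k z + ε :=
  exists_lt_of_csInf_lt (bounds_nonempty k z) (lt_add_of_pos_right _ hε)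

lemma tnorm_add_le_max (z w : E ⊗[k] L) : tnorm k (z + w) ≤ max (tnorm k z) (tnorm k w) := by
  refine le_of_forall_pos_le_add fun ε hε => ?_
  obtain ⟨C, ⟨hC, l, hl, hlC⟩, h1⟩ := exists_lt k z hε
  obtain ⟨C', ⟨hC', l', hl', hlC'⟩, h2⟩ := exists_lt k w hε
  have : tnorm k (z + w) ≤ max C C' := by
    refine csInf_le (bounds_bddBelow k _)
      ⟨le_max_of_le_left hC, l ++ l', by simp [hl, hl'], fun q hq => ?_⟩
    rcases List.mem_append.1 hq with h | h
    · exact (hlC q h).trans (le_max_left _ _)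
    · exact (hlC' q h).trans (le_max_right _ _)
  refine this.trans (max_le ?_ ?_)
  · exact h1.le.trans (by gcongr; exact le_max_left _ _)
  · exact h2.le.trans (by gcongr; exact le_max_right _ _)

lemma tnorm_neg_le (z : E ⊗[k] L) : tnorm k (-z) ≤ tnorm k z := by
  refine le_csInf (bounds_nonempty k z) ?_
  rintro C ⟨hC, l, hl, hlC⟩
  refine csInf_le (bounds_bddBelow k _) ⟨hC, l.map fun q => (-q.1, q.2), ?_, ?_⟩
  · rw [← hl, List.map_map]
    clear hl hlC
    induction l with
    | nil => simp
    | cons q l ih => simp_all [TensorProduct.neg_tmul, add_comm]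
  · intro q hq
    obtain ⟨q', hq', rfl⟩ := List.mem_map.1 hq
    simpa using hlC q' hq'

lemma tnorm_mul_le (z w : E ⊗[k] L) : tnorm k (z * w) ≤ tnorm k z * tnorm k w := by
  have key : ∀ C ∈ bounds k z, ∀ C' ∈ bounds k w, tnorm k (z * w) ≤ C * C' := by
    rintro C ⟨hC, l, hl, hlC⟩ C' ⟨hC', l', hl', hlC'⟩
    refine csInf_le (bounds_bddBelow k _) ⟨mul_nonneg hC hC',
      l.flatMap fun q => l'.map fun q' => (q.1 * q'.1, q.2 * q'.2), ?_, ?_⟩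
    · rw [← hl, ← hl']
      clear hl hl' hlC hlC'
      induction l with
      | nil => simp
      | cons q l ih =>
        simp only [List.flatMap_cons, List.map_append, List.sum_append, ih, List.map_cons,
          List.sum_cons, add_mul]
        congr 1
        rw [← List.sum_map_mul_left, List.map_map]
        simp [Function.comp_def]
    · intro q hq
      obtain ⟨a, ha, hq⟩ := List.mem_flatMap.1 hq
      obtain ⟨b, hb, rfl⟩ := List.mem_map.1 hq
      calc ‖a.1 * b.1‖ * ‖a.2 * b.2‖ ≤ (‖a.1‖ * ‖b.1‖) * (‖a.2‖ * ‖b.2‖) := by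
            gcongr <;> exact norm_mul_le _ _
        _ = (‖a.1‖ * ‖a.2‖) * (‖b.1‖ * ‖b.2‖) := by ring
        _ ≤ C * C' := by
            gcongr
            · exact hlC a ha
            · exact hlC' b hb
  have h1 : ∀ C ∈ bounds k z, tnorm k (z * w) ≤ C * tnorm k w := fun C hC => by
    rcases hC.1.eq_or_lt with h0 | h0
    · obtain ⟨C', hC'⟩ := bounds_nonempty k w
      simpa [← h0] using key C hC C' hC'
    · rw [← div_le_iff₀' h0]
      exact le_csInf (bounds_nonempty k w) fun C' hC' =>
        (div_le_iff₀' h0).2 (key C hC C' hC')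
  rcases (tnorm_nonneg k w).eq_or_lt with h0 | h0
  · obtain ⟨C, hC⟩ := bounds_nonempty k z
    simpa [← h0] using h1 C hC
  · rw [← div_le_iff₀ h0]
    exact le_csInf (bounds_nonempty k z) fun C hC => (div_le_iff₀ h0).2 (h1 C hC)

end Seminorm

variable (k E L : Type*) [NormedField k] [NormedRing E] [NormedAlgebra k E]
  [NormedRing L] [NormedAlgebra k L]

instance : Ring (UTensor k E L) := inferInstanceAs (Ring (E ⊗[k] L))

instance : SeminormedRing (UTensor k E L) :=
  RingSeminorm.toSeminormedRing
    { toFun := fun z : E ⊗[k] L => tnorm k z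
      map_zero' := tnorm_zero k
      add_le' := fun z w => (tnorm_add_le_max k z w).trans
        (max_le_add_of_nonneg (tnorm_nonneg k z) (tnorm_nonneg k w))
      neg' := fun z => le_antisymm (tnorm_neg_le k z)
        ((congrArg (tnorm k) (neg_neg z)).symm.le.trans (tnorm_neg_le k (-z)))
      mul_le' := tnorm_mul_le k }

variable {E L}

/-- The pure tensor `a ⊗ b`. -/
def mk (a : E) (b : L) : UTensor k E L := a ⊗ₜ[k] b

end UTensor

/-- The completed tensor product `E ⊗̂_k L`, a Banach ring. -/
abbrev CTensor (k E L : Type*) [NormedField k] [NormedRing E] [NormedAlgebra k E]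
    [NormedRing L] [NormedAlgebra k L] : Type _ :=
  UniformSpace.Completion (UTensor k E L)

/-! ## The Berkovich affine line -/

/-- The analytic affine line over `k`: multiplicative seminorms on `k[T]` that extend the
absolute value of `k`. -/
def BerkovichLine (k : Type*) [NormedField k] : Type _ :=
  {x : MulRingSeminorm k[X] // ∀ a : k, x (C a) = ‖a‖}

namespace BerkovichLine

variable {k : Type*} [NormedField k] (x : BerkovichLine k)

/-- The value `|f(x)|`. -/
def eval (f : k[X]) : ℝ := x.1 f

lemma eval_C (a : k) : x.eval (C a) = ‖a‖ := x.2 a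
lemma eval_zero : x.eval 0 = 0 := map_zero x.1
lemma eval_one : x.eval 1 = 1 := map_one x.1
lemma eval_mul (f g : k[X]) : x.eval (f * g) = x.eval f * x.eval g := map_mul x.1 f g
lemma eval_nonneg (f : k[X]) : 0 ≤ x.eval f := apply_nonneg x.1 f
lemma eval_add_le (f g : k[X]) : x.eval (f + g) ≤ x.eval f + x.eval g := map_add_le_add x.1 f g
lemma eval_sub_le (f g : k[X]) : x.eval (f - g) ≤ x.eval f + x.eval g := map_sub_le_add x.1 f g
lemma eval_neg (f : k[X]) : x.eval (-f) = x.eval f := map_neg_eq_map x.1 f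

/-- The prime ideal of polynomials that vanish at `x`. -/
def ker : Ideal k[X] where
  carrier := {f | x.eval f = 0}
  zero_mem' := x.eval_zero
  add_mem' {f g} hf hg := by
    have hf : x.eval f = 0 := hf
    have hg : x.eval g = 0 := hg
    exact le_antisymm ((x.eval_add_le f g).trans (by rw [hf, hg, add_zero])) (x.eval_nonneg _)
  smul_mem' c f hf := by
    have : x.eval f = 0 := hf
    simp [x.eval_mul, this]

lemma mem_ker {f : k[X]} : f ∈ x.ker ↔ x.eval f = 0 := Iff.rfl

instance : x.ker.IsPrime where
  ne_top' h := by
    have : (1 : k[X]) ∈ x.ker := h ▸ Submodule.mem_top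
    rw [mem_ker, eval_one] at this
    exact one_ne_zero this
  mem_or_mem' {f g} h := by
    rw [mem_ker, eval_mul, mul_eq_zero] at h
    exact h

/-- The residue field `Frac(k[T] / ker x)` of the point `x`, before completion. -/
def ResField : Type _ := FractionRing (k[X] ⧸ x.ker)

instance : Field x.ResField := inferInstanceAs (Field (FractionRing (k[X] ⧸ x.ker)))

instance : Algebra k[X] x.ResField :=
  ((algebraMap (k[X] ⧸ x.ker) (FractionRing (k[X] ⧸ x.ker))).comp
    (Ideal.Quotient.mk x.ker)).toAlgebra

/-- The evaluation `k[T] → Frac(k[T] / ker x)`. -/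
def toRes : k[X] →+* x.ResField := algebraMap k[X] x.ResField

instance : Algebra k x.ResField := (x.toRes.comp C).toAlgebra

lemma algebraMap_res (a : k) : algebraMap k x.ResField a = x.toRes (C a) := rfl

lemma toRes_eq_zero {f : k[X]} : x.toRes f = 0 ↔ x.eval f = 0 := by
  have h : algebraMap (k[X] ⧸ x.ker) (FractionRing (k[X] ⧸ x.ker)) (Ideal.Quotient.mk x.ker f) = 0 ↔
      x.eval f = 0 := by
    rw [FaithfulSMul.algebraMap_eq_zero_iff, Ideal.Quotient.eq_zero_iff_mem, mem_ker]
  exact h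

lemma toRes_ne_zero {f : k[X]} : x.toRes f ≠ 0 ↔ x.eval f ≠ 0 := x.toRes_eq_zero.not

lemma exists_frac (z : x.ResField) : ∃ q : k[X] × k[X], x.eval q.2 ≠ 0 ∧
    z = x.toRes q.1 / x.toRes q.2 := by
  obtain ⟨a, b, hb, rfl⟩ := IsFractionRing.div_surjective (A := k[X] ⧸ x.ker)
    (K := FractionRing (k[X] ⧸ x.ker)) z
  obtain ⟨f, rfl⟩ := Ideal.Quotient.mk_surjective a
  obtain ⟨g, rfl⟩ := Ideal.Quotient.mk_surjective b
  refine ⟨(f, g), ?_, rfl⟩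
  intro h
  exact nonZeroDivisors.ne_zero hb (Ideal.Quotient.eq_zero_iff_mem.2 h)

/-- Numerator and denominator of some representation of `z` as a fraction. -/
def frac (z : x.ResField) : k[X] × k[X] := (x.exists_frac z).choose

lemma frac_ne (z : x.ResField) : x.eval (x.frac z).2 ≠ 0 := (x.exists_frac z).choose_spec.1

lemma frac_eq (z : x.ResField) : z = x.toRes (x.frac z).1 / x.toRes (x.frac z).2 :=
  (x.exists_frac z).choose_spec.2

lemma eval_sub_eq_zero {f g f' g' : k[X]} (hg : x.eval g ≠ 0) (hg' : x.eval g' ≠ 0)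
    (h : x.toRes f / x.toRes g = x.toRes f' / x.toRes g') : x.eval (f * g' - f' * g) = 0 := by
  rw [← toRes_eq_zero, map_sub, map_mul, map_mul, sub_eq_zero]
  rwa [div_eq_div_iff (x.toRes_ne_zero.2 hg) (x.toRes_ne_zero.2 hg')] at h

/-- The absolute value of the residue field: `|f / g| = |f(x)| / |g(x)|`. -/
def resNorm (z : x.ResField) : ℝ := x.eval (x.frac z).1 / x.eval (x.frac z).2

lemma resNorm_div {f g : k[X]} (hg : x.eval g ≠ 0) :
    x.resNorm (x.toRes f / x.toRes g) = x.eval f / x.eval g := by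
  set z := x.toRes f / x.toRes g with hz
  have h := x.eval_sub_eq_zero hg (x.frac_ne z) (hz.symm.trans (x.frac_eq z))
  have h1 : x.eval (f * (x.frac z).2) = x.eval ((x.frac z).1 * g) := by
    refine le_antisymm ?_ ?_
    · have := x.eval_add_le (f * (x.frac z).2 - (x.frac z).1 * g) ((x.frac z).1 * g)
      rwa [h, sub_add_cancel, zero_add] at this
    · have := x.eval_sub_le (f * (x.frac z).2) (f * (x.frac z).2 - (x.frac z).1 * g)
      rwa [h, sub_sub_cancel, add_zero] at this
  rw [eval_mul, eval_mul] at h1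
  rw [resNorm, div_eq_div_iff (x.frac_ne z) hg, h1]

lemma resNorm_toRes (f : k[X]) : x.resNorm (x.toRes f) = x.eval f := by
  have := x.resNorm_div (f := f) (g := 1) (by simp [eval_one])
  simpa [eval_one] using this

/-- `resNorm` as an absolute value. -/
def resAbs : AbsoluteValue x.ResField ℝ where
  toFun := x.resNorm
  map_mul' z w := by
    rw [x.frac_eq z, x.frac_eq w, div_mul_div_comm, ← map_mul, ← map_mul,
      resNorm_div, resNorm_div, resNorm_div, eval_mul, eval_mul, div_mul_div_comm]
    · exact x.frac_ne w
    · exact x.frac_ne z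
    · rw [eval_mul]; exact mul_ne_zero (x.frac_ne z) (x.frac_ne w)
  nonneg' z := div_nonneg (x.eval_nonneg _) (x.eval_nonneg _)
  eq_zero' z := by
    conv_rhs => rw [x.frac_eq z]
    rw [resNorm, div_eq_zero_iff, div_eq_zero_iff, toRes_eq_zero, toRes_eq_zero]
  add_le' z w := by
    have hz := x.frac_ne z
    have hw := x.frac_ne w
    have hz' : 0 < x.eval (x.frac z).2 := lt_of_le_of_ne (x.eval_nonneg _) hz.symm
    have hw' : 0 < x.eval (x.frac w).2 := lt_of_le_of_ne (x.eval_nonneg _) hw.symm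
    rw [x.frac_eq z, x.frac_eq w, div_add_div _ _ (x.toRes_ne_zero.2 hz) (x.toRes_ne_zero.2 hw),
      ← map_mul, ← map_mul, ← map_mul, ← map_add, resNorm_div _ hz, resNorm_div _ hw,
      resNorm_div _ (by rw [eval_mul]; exact mul_ne_zero hz hw),
      div_add_div _ _ hz hw, ← eval_mul, ← eval_mul, ← eval_mul]
    have : 0 < x.eval ((x.frac z).2 * (x.frac w).2) := by rw [eval_mul]; positivity
    gcongr
    exact x.eval_add_le _ _

instance : NormedField x.ResField := x.resAbs.toNormedField

lemma norm_res (z : x.ResField) : ‖z‖ = x.resNorm z := rfl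

lemma norm_toRes (f : k[X]) : ‖x.toRes f‖ = x.eval f := x.resNorm_toRes f

instance : NormedAlgebra k x.ResField where
  norm_smul_le a z := by
    rw [Algebra.smul_def, norm_mul, algebraMap_res, norm_toRes, eval_C]

/-- The completed residue field `ℋ(x)` of the point `x`. -/
abbrev H : Type _ := UniformSpace.Completion x.ResField

/-- The value `f(x) ∈ ℋ(x)` of the polynomial `f` at `x`. -/
def val (f : k[X]) : x.H := ((x.toRes f : x.ResField) : x.H)

/-- The `k`-rational point `a` of the affine line, `|f(a)| = ‖f(a)‖`. -/
def ofPoint (a : k) : BerkovichLine k :=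
  ⟨{ toFun := fun f => ‖f.eval a‖
     map_zero' := by simp
     add_le' := fun f g => by simpa using norm_add_le _ _
     neg' := fun f => by simp
     map_one' := by simp
     map_mul' := fun f g => by simp }, fun b => by
      change ‖(C b).eval a‖ = ‖b‖
      simp⟩

/-- The point `x_{0,r}` with `r > 0`: `|∑ aᵢ Tⁱ| = max ‖aᵢ‖ rⁱ`. -/
def gaussPoint [IsUltrametricDist k] (r : ℝ) (hr : 0 < r) : BerkovichLine k :=
  have hna : IsNonarchimedean (NormedField.toAbsoluteValue k) :=
    IsUltrametricDist.isNonarchimedean_norm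
  ⟨{ toFun := fun f => f.gaussNorm (NormedField.toAbsoluteValue k) r
     map_zero' := by simp
     add_le' := fun f g => ((isNonarchimedean_gaussNorm _ hna hr.le) f g).trans
        (max_le_add_of_nonneg (gaussNorm_nonneg _ _ hr.le) (gaussNorm_nonneg _ _ hr.le))
     neg' := fun f => by
        have hC : (C (-1 : k)).gaussNorm (NormedField.toAbsoluteValue k) r = 1 := by
          rw [gaussNorm_C, map_neg_eq_map, map_one]
        rw [← neg_one_mul, ← C_1, ← C_neg, gaussNorm_mul hna hr, hC, one_mul]
     map_one' := by rw [← C_1, gaussNorm_C, map_one]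
     map_mul' := fun f g => gaussNorm_mul hna hr f g }, fun b => by
      change (C b).gaussNorm _ r = _
      rw [gaussNorm_C]; rfl⟩

lemma gaussPoint_eval [IsUltrametricDist k] (r : ℝ) (hr : 0 < r) (f : k[X]) :
    (gaussPoint r hr).eval f = f.gaussNorm (NormedField.toAbsoluteValue k) r := rfl

/-! ## Extension of bounded derivations to `ℋ(x)` -/

/-- The quotient rule: `d(f / g) = (d f * g - f * d g) / g ^ 2`. -/
def derivFun (d : Derivation k k[X] k[X]) (z : x.ResField) : x.ResField :=
  x.toRes (d (x.frac z).1 * (x.frac z).2 - (x.frac z).1 * d (x.frac z).2) /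
    x.toRes ((x.frac z).2 * (x.frac z).2)

variable {x} in
lemma derivFun_div {d : Derivation k k[X] k[X]} {K : ℝ} (hd : ∀ f, x.eval (d f) ≤ K * x.eval f)
    {f g : k[X]} (hg : x.eval g ≠ 0) :
    x.derivFun d (x.toRes f / x.toRes g) =
      x.toRes (d f * g - f * d g) / x.toRes (g * g) := by
  set z := x.toRes f / x.toRes g with hz
  have hg' := x.frac_ne z
  have h := x.eval_sub_eq_zero hg hg' (hz.symm.trans (x.frac_eq z))
  have h2 : x.toRes (d (f * (x.frac z).2 - (x.frac z).1 * g)) = 0 := by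
    rw [toRes_eq_zero]
    exact le_antisymm ((hd _).trans (by rw [h, mul_zero])) (x.eval_nonneg _)
  rw [← toRes_eq_zero] at h
  have r1 := x.toRes_ne_zero.2 hg
  have r2 := x.toRes_ne_zero.2 hg'
  unfold derivFun
  generalize (x.frac z).1 = f' at *
  generalize (x.frac z).2 = g' at *
  simp only [map_sub, map_mul, Derivation.leibniz, smul_eq_mul, map_add] at *
  field_simp
  linear_combination (-x.toRes g' * x.toRes g) * h2 +
    (x.toRes (d g') * x.toRes g + x.toRes g' * x.toRes (d g)) * h

/-- A `k`-derivation `d` of `k[T]` with `|d f|_x ≤ K |f|_x` as an operator on the residue field. -/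
def derivRes (d : Derivation k k[X] k[X]) (K : ℝ) (hd : ∀ f, x.eval (d f) ≤ K * x.eval f) :
    x.ResField →ₗ[k] x.ResField where
  toFun := x.derivFun d
  map_add' z w := by
    have hz := x.frac_ne z
    have hw := x.frac_ne w
    have hz' := x.toRes_ne_zero.2 hz
    have hw' := x.toRes_ne_zero.2 hw
    rw [x.frac_eq z, x.frac_eq w, div_add_div _ _ hz' hw',
      ← map_mul, ← map_mul, ← map_mul, ← map_add, derivFun_div hd hz, derivFun_div hd hw,
      derivFun_div hd (by rw [eval_mul]; exact mul_ne_zero hz hw)]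
    simp only [map_sub, map_mul, Derivation.leibniz, smul_eq_mul, map_add]
    field_simp
    ring
  map_smul' a z := by
    have hz := x.frac_ne z
    have hz' := x.toRes_ne_zero.2 hz
    rw [x.frac_eq z, Algebra.smul_def, algebraMap_res, mul_div_assoc', ← map_mul,
      derivFun_div hd hz, derivFun_div hd hz, RingHom.id_apply, Algebra.smul_def, algebraMap_res]
    have : d (C a) = 0 := d.map_algebraMap a
    simp only [map_sub, map_mul, Derivation.leibniz, smul_eq_mul, this, mul_zero, add_zero]
    field_simp

lemma norm_derivRes_le (d : Derivation k k[X] k[X]) (K : ℝ)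
    (hd : ∀ f, x.eval (d f) ≤ K * x.eval f) (z : x.ResField) :
    ‖x.derivRes d K hd z‖ ≤ (2 * K) * ‖z‖ := by
  have hz := x.frac_ne z
  have hz0 : 0 < x.eval (x.frac z).2 := lt_of_le_of_ne (x.eval_nonneg _) hz.symm
  change ‖x.derivFun d z‖ ≤ _
  conv_lhs => rw [derivFun]
  conv_rhs => rw [x.frac_eq z]
  rw [norm_div, norm_div, norm_toRes, norm_toRes, norm_toRes, norm_toRes, eval_mul,
    div_le_iff₀ (by positivity)]
  refine (x.eval_sub_le _ _).trans ?_
  rw [eval_mul, eval_mul]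
  have h1 := hd (x.frac z).1
  have h2 := hd (x.frac z).2
  have e : 2 * K * (x.eval (x.frac z).1 / x.eval (x.frac z).2) *
      (x.eval (x.frac z).2 * x.eval (x.frac z).2) =
      (K * x.eval (x.frac z).1) * x.eval (x.frac z).2 +
        x.eval (x.frac z).1 * (K * x.eval (x.frac z).2) := by
    field_simp; ring
  rw [e]
  have := x.eval_nonneg (x.frac z).1
  gcongr

end BerkovichLine

namespace BerkovichLine

variable {k : Type*} [NontriviallyNormedField k] (x : BerkovichLine k)

/-- The continuous extension to `ℋ(x)` of a `k`-derivation `d` of `k[T]` that is bounded at `x`,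
as an element of the Banach algebra of bounded `k`-linear operators on `ℋ(x)`. -/
def derivH (d : Derivation k k[X] k[X]) (K : ℝ) (hd : ∀ f, x.eval (d f) ≤ K * x.eval f) :
    x.H →L[k] x.H :=
  ((UniformSpace.Completion.toComplL (𝕜 := k) (E := x.ResField)).comp
    ((x.derivRes d K hd).mkContinuous (2 * K) (x.norm_derivRes_le d K hd))).extend
    (UniformSpace.Completion.toComplL (𝕜 := k) (E := x.ResField))

lemma derivH_coe (d : Derivation k k[X] k[X]) (K : ℝ) (hd : ∀ f, x.eval (d f) ≤ K * x.eval f)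
    (z : x.ResField) : x.derivH d K hd (z : x.H) = (x.derivRes d K hd z : x.H) :=
  ContinuousLinearMap.extend_eq _ (e := UniformSpace.Completion.toComplL (𝕜 := k) (E := x.ResField))
    UniformSpace.Completion.denseRange_coe
    (UniformSpace.Completion.isUniformInducing_coe _) z

variable [IsUltrametricDist k]

lemma eval_X_smul_derivative_le (r : ℝ) (hr : 0 < r) (f : k[X]) :
    (gaussPoint r hr).eval (((X : k[X]) • derivative' : Derivation k k[X] k[X]) f) ≤ 1 * (gaussPoint r hr).eval f := by
  rw [one_mul, gaussPoint_eval, gaussPoint_eval, Derivation.smul_apply, smul_eq_mul]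
  change (X * derivative f).gaussNorm _ r ≤ _
  obtain ⟨i, hi⟩ := exists_eq_gaussNorm (NormedField.toAbsoluteValue k) r (X * derivative f)
  rw [hi]
  refine le_trans ?_ (le_gaussNorm (NormedField.toAbsoluteValue k) f hr.le i)
  gcongr
  change ‖_‖ ≤ ‖_‖
  rcases i with _ | i
  · simp
  · rw [coeff_X_mul, coeff_derivative, norm_mul]
    have := IsUltrametricDist.norm_natCast_le_one k (i + 1)
    push_cast at this
    exact mul_le_of_le_one_right (norm_nonneg _) this

/-- The derivation `S d/dS` as a bounded operator on `ℋ(x_{0,r})`, where `S = T(x_{0,r})`. -/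
def eulerOp (r : ℝ) (hr : 0 < r) : (gaussPoint (k := k) r hr).H →L[k] (gaussPoint (k := k) r hr).H :=
  (gaussPoint r hr).derivH ((X : k[X]) • derivative') 1 (eval_X_smul_derivative_le r hr)

end BerkovichLine

/-- The spectrum in the sense of Berkovich of an element `f` of a `k`-Banach algebra `E`: the points
`x` of the affine line such that `f ⊗ 1 - 1 ⊗ T(x)` is not invertible in `E ⊗̂_k ℋ(x)`. -/
def berkovichSpectrum (k : Type*) {E : Type*} [NormedField k] [NormedRing E] [NormedAlgebra k E]
    (f : E) : Set (BerkovichLine k) :=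
  {x | ¬ IsUnit ((UTensor.mk k f (1 : x.H) - UTensor.mk k (1 : E) (x.val X) : UTensor k E x.H) :
    CTensor k E x.H)}

end

/-! Write D for S d/dS and (a)_n for the falling factorial a(a-1)⋯(a-n+1).

The spectrum lies in ℤ_p because (D)_n, which is Sⁿ(d/dS)ⁿ, is small: it multiplies Tⁱ by n!·C(i,n),
so its norm is at most |n!| on polynomials, and the Leibniz rule carries this bound to fractions and
to the completion (`norm_descProd_eulerOp_le`). If x is not in ℤ_p, compactness keeps |T - a| away
from 0 at x for a in ℤ_p, and taking n a high power of p gives |(T)_n| > |n!| at x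
(`exists_norm_factorial_lt_prod_eval`). A Neumann series then inverts (D)_n ⊗ 1 - 1 ⊗ (T(x))_n.
Since D ⊗ 1 - 1 ⊗ T(x) divides this element and commutes with the quotient, it is invertible too
(`notMem_berkovichSpectrum`).

Conversely, ℋ(b) = k at a rational point b, so invertibility in the completed tensor product would
make D - b invertible. For b in ℤ_p this fails: Sⁿ is an eigenvector of eigenvalue n, and natural
numbers n come arbitrarily close to b (`not_isUnit_eulerOp_sub`). -/

noncomputable section

/-! ## Falling factorials in rings -/

/-- The falling factorial `a (a - 1) ⋯ (a - n + 1)` of an element of a ring. -/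
def descProd {A : Type*} [Ring A] (a : A) : ℕ → A
  | 0 => 1
  | n + 1 => (a - n) * descProd a n

section DescProd

variable {A B : Type*} [Ring A] [Ring B]

@[simp] lemma descProd_zero (a : A) : descProd a 0 = 1 := rfl

lemma descProd_succ (a : A) (n : ℕ) : descProd a (n + 1) = (a - n) * descProd a n := rfl

lemma map_descProd (φ : A →+* B) (a : A) (n : ℕ) : φ (descProd a n) = descProd (φ a) n := by
  induction n with
  | zero => simp
  | succ n ih => simp [descProd_succ, ih]

lemma Commute.descProd_right {a b : A} (h : Commute a b) (n : ℕ) : Commute a (descProd b n) := by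
  induction n with
  | zero => exact Commute.one_right a
  | succ n ih => exact (h.sub_right (Nat.cast_commute n a).symm).mul_right ih

/-- For commuting `a` and `b`, the difference `a - b` divides the difference of the falling
factorials, by an element commuting with both. -/
lemma exists_sub_mul_eq_descProd_sub {a b : A} (h : Commute a b) (n : ℕ) :
    ∃ q, Commute (a - b) q ∧ (a - b) * q = descProd a n - descProd b n := by
  induction n with
  | zero => exact ⟨0, Commute.zero_right _, by simp⟩
  | succ n ih =>
    obtain ⟨q, hq, e⟩ := ih
    have hn : Commute (a - b) (b - (n : A)) :=
      (h.sub_left (Commute.refl b)).sub_right (Nat.cast_commute n (a - b)).symm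
    have ha : Commute (a - b) (descProd a n) :=
      ((Commute.refl a).sub_left h.symm).descProd_right n
    -- From (a-n)A - (b-n)B = (a-b)A + (b-n)(A-B), with A and B the falling factorials of order n.
    refine ⟨descProd a n + (b - n) * q, ha.add_right (hn.mul_right hq), ?_⟩
    rw [descProd_succ, descProd_succ, mul_add, ← mul_assoc (a - b), hn.eq, mul_assoc, e]
    noncomm_ring

end DescProd

/-- The Vandermonde-type Leibniz rule for the falling factorials of a derivation. -/
lemma descProd_leibniz {k R : Type*} [CommRing k] [CommRing R] [Algebra k R]
    (D : Module.End k R) (hD : ∀ z w, D (z * w) = D z * w + z * D w) (z w : R) (n : ℕ) :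
    descProd D n (z * w) = ∑ ij ∈ Finset.HasAntidiagonal.antidiagonal n,
      (n.choose ij.1 : R) * (descProd D ij.1 z * descProd D ij.2 w) := by
  have hs : ∀ (m : ℕ) (y : R), descProd D (m + 1) y = D (descProd D m y) - m * descProd D m y := by
    intro m y
    rw [descProd_succ, Module.End.mul_apply, LinearMap.sub_apply, Module.End.natCast_apply,
      nsmul_eq_mul]
  have hc : ∀ (m : ℕ) (y : R), D (m * y) = m * D y := by
    intro m y
    rw [← nsmul_eq_mul, map_nsmul, nsmul_eq_mul]
  induction n with
  | zero => simp
  | succ n ih =>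
    rw [Finset.sum_antidiagonal_choose_succ_mul
      (fun i j => descProd D i z * descProd D j w), ← Finset.sum_add_distrib, hs, ih, map_sum,
      Finset.mul_sum, ← Finset.sum_sub_distrib]
    refine Finset.sum_congr rfl fun ij hij => ?_
    have h := Finset.HasAntidiagonal.mem_antidiagonal.1 hij
    have hn : (n.choose ij.2 : R) = n.choose ij.1 := by
      rw [Nat.choose_symm_of_eq_add h.symm]
    rw [hc, hD, hs, hs, hn]
    -- On the (i, j) term, D - n splits as D - i acting on the first factor plus D - j acting on the
    -- second.
    have : (n : R) = ij.1 + ij.2 := by rw [← h]; push_cast; ring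
    rw [this]
    ring

/-! ### Falling factorials of a derivation on the residue field. -/

namespace BerkovichLine

section

variable {k : Type*} [NormedField k] (x : BerkovichLine k) (d : Derivation k k[X] k[X]) {K : ℝ}
  (hd : ∀ f, x.eval (d f) ≤ K * x.eval f)

lemma derivRes_div {f g : k[X]} (hg : x.eval g ≠ 0) :
    x.derivRes d K hd (x.toRes f / x.toRes g) = x.toRes (d f * g - f * d g) / x.toRes (g * g) :=
  derivFun_div hd hg

lemma derivRes_toRes (f : k[X]) : x.derivRes d K hd (x.toRes f) = x.toRes (d f) := by
  have h := x.derivRes_div d hd (f := f) (g := 1) (by simp [eval_one])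
  simpa using h

lemma derivRes_mul (z w : x.ResField) : x.derivRes d K hd (z * w) =
    x.derivRes d K hd z * w + z * x.derivRes d K hd w := by
  have hz := x.frac_ne z
  have hw := x.frac_ne w
  have hz' := x.toRes_ne_zero.2 hz
  have hw' := x.toRes_ne_zero.2 hw
  rw [x.frac_eq z, x.frac_eq w, div_mul_div_comm, ← map_mul, ← map_mul, derivRes_div _ _ _ hz,
    derivRes_div _ _ _ hw, derivRes_div _ _ _ (by rw [eval_mul]; exact mul_ne_zero hz hw)]
  simp only [map_sub, map_mul, Derivation.leibniz, smul_eq_mul, map_add]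
  field_simp
  ring

lemma descProd_derivRes_toRes (f : k[X]) (n : ℕ) :
    descProd (x.derivRes d K hd : Module.End k x.ResField) n (x.toRes f) =
      x.toRes (descProd (d : Module.End k k[X]) n f) := by
  induction n with
  | zero => simp
  | succ n ih =>
    simp only [descProd_succ, Module.End.mul_apply, LinearMap.sub_apply, Module.End.natCast_apply,
      ih, map_sub, map_nsmul, derivRes_toRes]
    rfl

/-- A multiplicative norm is ultrametric as soon as the natural numbers have norm at most 1, and
these norms are computed in k. -/
instance isUltrametricDist_resField [IsUltrametricDist k] : IsUltrametricDist x.ResField :=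
  IsUltrametricDist.isUltrametricDist_of_forall_norm_natCast_le_one fun n => by
    have : (n : x.ResField) = x.toRes (C (n : k)) := by simp
    rw [this, norm_toRes, eval_C]
    exact IsUltrametricDist.norm_natCast_le_one k n

/-- If the falling factorials of a derivation have norm at most `‖n!‖` on polynomials, then
also on rational functions. -/
lemma norm_descProd_derivRes_le [IsUltrametricDist k]
    (h : ∀ n f, x.eval (descProd (d : Module.End k k[X]) n f) ≤ ‖(n.factorial : k)‖ * x.eval f)
    (n : ℕ) (z : x.ResField) :
    ‖descProd (x.derivRes d K hd : Module.End k x.ResField) n z‖ ≤ ‖(n.factorial : k)‖ * ‖z‖ := by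
  set D : Module.End k x.ResField := x.derivRes d K hd with hD
  have hnat : ∀ m : ℕ, ‖(m : x.ResField)‖ = ‖(m : k)‖ := fun m => by
    rw [← map_natCast (algebraMap k x.ResField), norm_algebraMap']
  have hp : ∀ n f, ‖descProd D n (x.toRes f)‖ ≤ ‖(n.factorial : k)‖ * ‖x.toRes f‖ := by
    intro n f
    rw [hD, descProd_derivRes_toRes, norm_toRes, norm_toRes]
    exact h n f
  induction n using Nat.strong_induction_on with
  | _ n ih =>
  have hg := x.toRes_ne_zero.2 (x.frac_ne z)
  set f := (x.frac z).1
  set g := (x.frac z).2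
  have hz : z * x.toRes g = x.toRes f := by
    rw [x.frac_eq z]
    exact div_mul_cancel₀ _ hg
  have hg0 : 0 < ‖x.toRes g‖ := norm_pos_iff.2 hg
  -- Expanding (D)_n(z g) = (D)_n f isolates (D)_n(z) g as the (n, 0) term. The other terms involve
  -- only (D)_i z with i < n, so induction bounds them.
  have hL := descProd_leibniz D (x.derivRes_mul d hd) z (x.toRes g) n
  rw [hz, ← Finset.add_sum_erase _ _ (Finset.HasAntidiagonal.mem_antidiagonal.2 (add_zero n) :
    ((n, 0) : ℕ × ℕ) ∈ Finset.HasAntidiagonal.antidiagonal n)] at hL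
  simp only [Nat.choose_self, Nat.cast_one, one_mul, descProd_zero, Module.End.one_apply] at hL
  have hf : ‖x.toRes f‖ = ‖z‖ * ‖x.toRes g‖ := by rw [← hz, norm_mul]
  have hS : ‖∑ ij ∈ (Finset.HasAntidiagonal.antidiagonal n).erase (n, 0), (n.choose ij.1 : x.ResField) *
      (descProd D ij.1 z * descProd D ij.2 (x.toRes g))‖ ≤
      ‖(n.factorial : k)‖ * (‖z‖ * ‖x.toRes g‖) := by
    refine IsUltrametricDist.norm_sum_le_of_forall_le_of_nonneg (by positivity) fun ij hij => ?_
    obtain ⟨hne, hij⟩ := Finset.mem_erase.1 hij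
    have hij := Finset.HasAntidiagonal.mem_antidiagonal.1 hij
    have hlt : ij.1 < n := by
      rcases ij with ⟨i, j⟩
      simp only [Prod.mk.injEq, ne_eq, not_and] at hne hij ⊢
      omega
    -- The binomial coefficient of the Leibniz rule is what turns |i!||j!| into |n!|.
    have hfac : (n.factorial : k) = n.choose ij.1 * (ij.1.factorial * ij.2.factorial) := by
      rw [← Nat.choose_mul_factorial_mul_factorial hlt.le, show n - ij.1 = ij.2 by omega]
      push_cast; ring
    rw [norm_mul, norm_mul, hnat, hfac, norm_mul, norm_mul]
    calc _ ≤ ‖(n.choose ij.1 : k)‖ * ((‖(ij.1.factorial : k)‖ * ‖z‖) *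
          (‖(ij.2.factorial : k)‖ * ‖x.toRes g‖)) := by
          gcongr
          · exact ih _ hlt
          · exact hp _ _
      _ = _ := by ring
  refine le_of_mul_le_mul_right ?_ hg0
  rw [← norm_mul, ← sub_eq_iff_eq_add.2 hL, mul_assoc]
  rw [sub_eq_add_neg]
  refine (IsUltrametricDist.norm_add_le_max _ _).trans (max_le ?_ ((norm_neg _).trans_le hS))
  rw [← hf]
  exact hp n f

end

/-! ### The Euler operator on the completed residue field. -/

section

variable {k : Type*} [NontriviallyNormedField k] (x : BerkovichLine k)
  (d : Derivation k k[X] k[X]) {K : ℝ} (hd : ∀ f, x.eval (d f) ≤ K * x.eval f)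

lemma descProd_derivH_coe (n : ℕ) (z : x.ResField) :
    descProd (x.derivH d K hd) n (z : x.H) =
      (descProd (x.derivRes d K hd : Module.End k x.ResField) n z : x.ResField) := by
  have hsm : ∀ (m : ℕ) (y : x.H), (m : x.H →L[k] x.H) y = m • y := fun m y => by
    rw [← nsmul_one m, smul_apply, one_apply_eq_self]
  induction n with
  | zero => simp
  | succ n ih =>
    simp only [descProd_succ, Module.End.mul_apply, LinearMap.sub_apply, Module.End.natCast_apply,
      mul_apply_eq_comp, sub_apply, hsm, ih, derivH_coe]
    rw [UniformSpace.Completion.coe_sub]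
    congr 1
    exact (map_nsmul UniformSpace.Completion.toCompl n _).symm

lemma norm_descProd_derivH_le {C : ℝ} (hC : 0 ≤ C) (n : ℕ)
    (h : ∀ z, ‖descProd (x.derivRes d K hd : Module.End k x.ResField) n z‖ ≤ C * ‖z‖) :
    ‖descProd (x.derivH d K hd) n‖ ≤ C := by
  refine ContinuousLinearMap.opNorm_le_bound _ hC fun z => ?_
  induction z using UniformSpace.Completion.induction_on with
  | hp => exact isClosed_le (by fun_prop) (by fun_prop)
  | ih z =>
    rw [descProd_derivH_coe, UniformSpace.Completion.norm_coe, UniformSpace.Completion.norm_coe]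
    exact h z

/-- T d/dT is diagonal on monomials with eigenvalue i on Tⁱ, so its falling factorials are diagonal
as well. -/
lemma coeff_descProd_euler (n i : ℕ) (f : k[X]) :
    (descProd (((X : k[X]) • derivative' : Derivation k k[X] k[X]) : Module.End k k[X]) n f).coeff i
      = i.descFactorial n * f.coeff i := by
  have h : ∀ g : k[X], ((X : k[X]) • derivative' : Derivation k k[X] k[X]) g = X * derivative g :=
    fun g => rfl
  induction n with
  | zero => simp
  | succ n ih =>
    rw [descProd_succ, Module.End.mul_apply, LinearMap.sub_apply, Module.End.natCast_apply,
      Derivation.coeFn_coe, h, coeff_sub, coeff_smul, ih]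
    have e : ∀ g : k[X], (X * derivative g).coeff i = i * g.coeff i := by
      intro g
      rcases i with _ | i
      · simp
      · rw [coeff_X_mul, coeff_derivative]; push_cast; ring
    rw [e, ih, Nat.descFactorial_succ]
    rcases le_or_gt n i with hn | hn
    · push_cast [Nat.cast_sub hn]; simp only [nsmul_eq_mul]; ring
    · simp [Nat.descFactorial_of_lt hn]

variable [IsUltrametricDist k] (r : ℝ) (hr : 0 < r)

/-- The eigenvalue on Tⁱ is n! times a binomial coefficient, an integer of norm at most 1. -/
lemma eval_descProd_euler_le (n : ℕ) (f : k[X]) :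
    (gaussPoint r hr).eval
      (descProd (((X : k[X]) • derivative' : Derivation k k[X] k[X]) : Module.End k k[X]) n f) ≤
      ‖(n.factorial : k)‖ * (gaussPoint r hr).eval f := by
  rw [gaussPoint_eval, gaussPoint_eval]
  obtain ⟨i, hi⟩ := exists_eq_gaussNorm (NormedField.toAbsoluteValue k) r (descProd
    (((X : k[X]) • derivative' : Derivation k k[X] k[X]) : Module.End k k[X]) n f)
  rw [hi, coeff_descProd_euler]
  change ‖_‖ * _ ≤ _
  rw [Nat.descFactorial_eq_factorial_mul_choose, Nat.cast_mul, norm_mul, norm_mul]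
  have h1 := le_gaussNorm (NormedField.toAbsoluteValue k) f hr.le i
  have h2 := IsUltrametricDist.norm_natCast_le_one k (i.choose n)
  change ‖_‖ * _ ≤ _ at h1
  calc _ = ‖(n.factorial : k)‖ * (‖(i.choose n : k)‖ * (‖f.coeff i‖ * r ^ i)) := by ring
    _ ≤ ‖(n.factorial : k)‖ * (1 * (‖f.coeff i‖ * r ^ i)) := by gcongr
    _ ≤ _ := by rw [one_mul]; gcongr

/-- The falling factorial `S^n (d/dS)^n` of `S d/dS` has norm at most `‖n!‖`. -/
lemma norm_descProd_eulerOp_le (n : ℕ) :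
    ‖descProd (eulerOp (k := k) r hr) n‖ ≤ ‖(n.factorial : k)‖ :=
  norm_descProd_derivH_le _ _ _ (norm_nonneg _) n
    (norm_descProd_derivRes_le _ _ _ (eval_descProd_euler_le r hr) n)

/-- `S^n` is an eigenvector of `S d/dS` with eigenvalue `n`. -/
lemma eulerOp_pow (n : ℕ) :
    eulerOp r hr ((gaussPoint (k := k) r hr).val (X ^ n)) =
      (n : k) • (gaussPoint (k := k) r hr).val (X ^ n) := by
  rw [eulerOp, val, derivH_coe, derivRes_toRes, ← UniformSpace.Completion.coe_smul]
  congr 1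
  rw [Algebra.smul_def, algebraMap_res, ← map_mul]
  congr 1
  change (X : k[X]) * derivative (X ^ n) = _
  rcases n with _ | n
  · simp
  · rw [derivative_X_pow, Nat.add_sub_cancel]; ring

lemma val_X_pow_ne_zero (n : ℕ) : (gaussPoint (k := k) r hr).val ((X : k[X]) ^ n) ≠ 0 := by
  rw [← norm_pos_iff, val, UniformSpace.Completion.norm_coe, norm_toRes, gaussPoint_eval,
    ← monomial_one_right_eq_X_pow (R := k), gaussNorm_monomial, map_one]
  positivity

end

end BerkovichLine

/-! ## The continuous homomorphism from the `p`-adic integers -/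

section PadicHom

variable {k : Type*} [NormedField k] [IsUltrametricDist k] (p : ℕ)

lemma norm_natCast_lt_one_of_charP_residueField
    (hp : CharP (IsLocalRing.ResidueField
      (NormedField.valuation (K := k)).valuationSubring) p) : ‖(p : k)‖ < 1 := by
  set O := (NormedField.valuation (K := k)).valuationSubring
  have h : IsLocalRing.residue O (p : O) = 0 := by
    rw [map_natCast]; exact CharP.cast_eq_zero _ p
  rw [IsLocalRing.residue_eq_zero_iff, ValuationSubring.valuation_lt_one_iff] at h
  have h2 : NormedField.valuation (((p : O) : k)) < 1 :=
    (Valuation.isEquiv_valuation_valuationSubring _).lt_one_iff_lt_one.2 h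
  exact h2

variable {p} in
lemma norm_intCast_le_pow_of_dvd {m : ℤ} {n : ℕ} (h : (p ^ n : ℤ) ∣ m) :
    ‖(m : k)‖ ≤ ‖(p : k)‖ ^ n := by
  obtain ⟨c, rfl⟩ := h
  push_cast
  rw [norm_mul, norm_pow]
  exact mul_le_of_le_one_right (by positivity) (IsUltrametricDist.norm_intCast_le_one k c)

lemma existsUnique_continuous_padicInt_ringHom [Fact p.Prime] [CompleteSpace k] (hp : ‖(p : k)‖ < 1) :
    ∃! ι : ℤ_[p] →+* k, Continuous ι := by
  have hu : ∀ ι κ : ℤ_[p] →+* k, Continuous ι → Continuous κ → ι = κ := by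
    intro ι κ hι hκ
    refine DFunLike.coe_injective (PadicInt.denseRange_natCast.equalizer hι hκ ?_)
    ext n
    simp
  suffices h : ∃ ι : ℤ_[p] →+* k, Continuous ι by
    obtain ⟨ι, hι⟩ := h
    exact ⟨ι, hι, fun κ hκ => hu κ ι hκ hι⟩
  -- With the p-adic uniformity, ℤ is dense in ℤ_p. Its cast to k is uniformly continuous because
  -- |p| < 1, so it extends by completeness of k.
  let _ : UniformSpace ℤ := UniformSpace.comap (Int.castRingHom ℤ_[p]) inferInstance
  have ue : IsUniformInducing (Int.castRingHom ℤ_[p]) := ⟨rfl⟩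
  have dr : DenseRange (Int.castRingHom ℤ_[p]) := PadicInt.denseRange_intCast
  have hf : UniformContinuous (Int.castRingHom k) := by
    rw [(ue.basis_uniformity Metric.uniformity_basis_dist).uniformContinuous_iff
      Metric.uniformity_basis_dist]
    intro ε hε
    obtain ⟨n, hn⟩ := exists_pow_lt_of_lt_one hε hp
    refine ⟨(p : ℝ) ^ (-n : ℤ), zpow_pos (by exact_mod_cast (Fact.out : p.Prime).pos) _,
      fun a b hab => ?_⟩
    have hab : dist ((a : ℤ) : ℤ_[p]) (b : ℤ_[p]) < (p : ℝ) ^ (-n : ℤ) := hab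
    rw [dist_eq_norm, ← Int.cast_sub] at hab
    change dist (a : k) (b : k) < ε
    rw [dist_eq_norm, ← Int.cast_sub]
    exact (norm_intCast_le_pow_of_dvd ((PadicInt.norm_int_le_pow_iff_dvd).1 hab.le)).trans_lt hn
  exact ⟨IsDenseInducing.extendRingHom ue dr hf,
    (uniformContinuous_uniformly_extend ue dr hf).continuous⟩

end PadicHom

/-! ### Size of falling factorials at points outside ℤ_p. -/

namespace BerkovichLine

section

variable {k : Type*} [NormedField k] (x : BerkovichLine k)

/-- T - b divides f - f(b), so f and the constant f(b) have the same value at x. -/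
lemma eq_ofPoint_of_eval_eq_zero {b : k} (h : x.eval (X - C b) = 0) : x = ofPoint b := by
  have hz : ∀ f : k[X], x.eval (f - C (f.eval b)) = 0 := by
    intro f
    obtain ⟨g, hg⟩ := X_sub_C_dvd_sub_C_eval (p := f) (a := b)
    rw [hg, eval_mul, h, zero_mul]
  refine Subtype.ext (DFunLike.ext _ _ fun f => ?_)
  change x.eval f = ‖f.eval b‖
  rw [← x.eval_C]
  refine le_antisymm ?_ ?_
  · simpa [hz] using x.eval_add_le (f - C (f.eval b)) (C (f.eval b))
  · simpa [hz] using x.eval_sub_le f (f - C (f.eval b))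

lemma eval_ofPoint (b : k) (f : k[X]) : (ofPoint b).eval f = ‖f.eval b‖ := rfl

lemma continuous_eval_X_sub_C : Continuous fun b : k => x.eval (X - C b) := by
  refine LipschitzWith.continuous (K := 1) (LipschitzWith.of_le_add fun b c => ?_)
  have h := x.eval_add_le (X - C c) (C c - C b)
  rwa [sub_add_sub_cancel, ← C_sub, eval_C, ← dist_eq_norm, dist_comm] at h

variable [IsUltrametricDist k]

lemma norm_sub_le_max_eval (b c : k) : ‖b - c‖ ≤ max (x.eval (X - C b)) (x.eval (X - C c)) := by
  have h := IsUltrametricDist.norm_add_le_max (x.toRes (X - C c)) (-x.toRes (X - C b))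
  rw [← sub_eq_add_neg, norm_neg, ← map_sub, norm_toRes, norm_toRes, norm_toRes, sub_sub_sub_cancel_left, ← C_sub, eval_C,
    max_comm] at h
  exact h

/-- If `|T - i|` is bounded below by `δ` at `x` for `i < n`, and `‖n‖ < δ`, then
`|T (T - 1) ⋯ (T - n + 1)| > ‖n!‖` at `x`. -/
lemma norm_factorial_lt_prod_eval [CharZero k] {δ : ℝ} (n : ℕ) (hn : 0 < n)
    (hδ : ∀ i : ℕ, δ ≤ x.eval (X - C (i : k))) (hnδ : ‖(n : k)‖ < δ) :
    ‖(n.factorial : k)‖ < ∏ i ∈ Finset.range n, x.eval (X - C (i : k)) := by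
  -- Let i₀ be an integer of the range closest to x. The ultrametric inequality gives |T - i| ≥ |i -
  -- i₀| for the others, while the factor at i₀ is at least δ > |n|.
  obtain ⟨i₀, hi₀, hmin⟩ := Finset.exists_min_image (Finset.range n)
    (fun i : ℕ => x.eval (X - C (i : k))) ⟨0, Finset.mem_range.2 hn⟩
  have hi₀n := Finset.mem_range.1 hi₀
  rw [← Finset.mul_prod_erase _ _ hi₀]
  have h1 : ∏ i ∈ (Finset.range n).erase i₀, ‖(i : k) - i₀‖ ≤
      ∏ i ∈ (Finset.range n).erase i₀, x.eval (X - C (i : k)) := by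
    refine Finset.prod_le_prod (fun _ _ => norm_nonneg _) fun i hi => ?_
    refine (x.norm_sub_le_max_eval i i₀).trans (max_le le_rfl ?_)
    exact hmin i (Finset.mem_of_mem_erase hi)
  have h2 : ∏ i ∈ (Finset.range n).erase i₀, ‖(i : k) - i₀‖ =
      ‖(i₀.factorial : k)‖ * ‖((n - 1 - i₀).factorial : k)‖ := by
    have hsplit : (Finset.range n).erase i₀ =
        Finset.range i₀ ∪ (Finset.range (n - 1 - i₀)).image (fun j => j + 1 + i₀) := by
      ext i
      simp only [Finset.mem_erase, Finset.mem_range, Finset.mem_union, Finset.mem_image]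
      constructor
      · rintro ⟨h, h'⟩
        rcases lt_or_gt_of_ne h with h | h
        · exact Or.inl h
        · exact Or.inr ⟨i - 1 - i₀, by omega, by omega⟩
      · rintro (h | ⟨j, h, rfl⟩) <;> omega
    have hdisj : Disjoint (Finset.range i₀)
        ((Finset.range (n - 1 - i₀)).image (fun j => j + 1 + i₀)) := by
      rw [Finset.disjoint_left]
      simp only [Finset.mem_range, Finset.mem_image, not_exists, not_and]
      intro i hi j _ h
      omega
    rw [hsplit, Finset.prod_union hdisj, Finset.prod_image (by intro a _ b _ h; simpa using h)]
    congr 1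
    · rw [← Finset.prod_range_add_one_eq_factorial, Nat.cast_prod, norm_prod,
        ← Finset.prod_range_reflect]
      refine Finset.prod_congr rfl fun i hi => ?_
      have hi := Finset.mem_range.1 hi
      rw [norm_sub_rev, ← Nat.cast_sub (by omega)]
      congr 2
      omega
    · rw [← Finset.prod_range_add_one_eq_factorial, Nat.cast_prod, norm_prod]
      refine Finset.prod_congr rfl fun i hi => ?_
      push_cast
      ring_nf
  -- The ratio of the two sides is the norm of a binomial coefficient.
  have h3 : ‖((n - 1).factorial : k)‖ ≤ ‖(i₀.factorial : k)‖ * ‖((n - 1 - i₀).factorial : k)‖ := by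
    rw [← Nat.choose_mul_factorial_mul_factorial (show i₀ ≤ n - 1 by omega)]
    push_cast
    rw [norm_mul, norm_mul, mul_assoc]
    exact mul_le_of_le_one_left (by positivity) (IsUltrametricDist.norm_natCast_le_one k _)
  have h4 : 0 < ‖((n - 1).factorial : k)‖ :=
    norm_pos_iff.2 (Nat.cast_ne_zero.2 (Nat.factorial_ne_zero _))
  calc ‖(n.factorial : k)‖ = ‖(n : k)‖ * ‖((n - 1).factorial : k)‖ := by
        rw [← Nat.mul_factorial_pred hn.ne', Nat.cast_mul, norm_mul]
    _ < δ * ‖((n - 1).factorial : k)‖ := by gcongr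
    _ ≤ _ := by
        gcongr
        · exact x.eval_nonneg _
        · exact hδ i₀
        · exact h3.trans (h2.symm.le.trans h1)

/-- Outside the image of `ℤ_p`, some `|T (T - 1) ⋯ (T - n + 1)|` exceeds `‖n!‖`. -/
lemma exists_norm_factorial_lt_prod_eval [CharZero k] {p : ℕ} [Fact p.Prime]
    (hp : ‖(p : k)‖ < 1) {ι : ℤ_[p] →+* k} (hι : Continuous ι)
    (hx : ∀ a, x ≠ ofPoint (ι a)) :
    ∃ n : ℕ, ‖(n.factorial : k)‖ < ∏ i ∈ Finset.range n, x.eval (X - C (i : k)) := by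
  -- By compactness of ℤ_p the distance to x is attained. It is positive because x is not in the
  -- image, and it serves as δ.
  obtain ⟨a, -, ha⟩ := isCompact_univ.exists_isMinOn Set.univ_nonempty
    (x.continuous_eval_X_sub_C.comp hι).continuousOn
  have hpos : 0 < x.eval (X - C (ι a)) :=
    lt_of_le_of_ne (x.eval_nonneg _) fun h => hx a (x.eq_ofPoint_of_eval_eq_zero h.symm)
  obtain ⟨m, hm⟩ := exists_pow_lt_of_lt_one hpos hp
  refine ⟨p ^ m, x.norm_factorial_lt_prod_eval (δ := x.eval (X - C (ι a))) _
    (pow_pos (Fact.out : p.Prime).pos m) (fun i => ?_) (by simpa using hm)⟩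
  simpa using ha (Set.mem_univ (i : ℤ_[p]))

end

end BerkovichLine

/-! ## Points of the spectrum -/

namespace UTensor

variable (k : Type*) {E L : Type*} [NormedField k] [NormedRing E] [NormedAlgebra k E]
  [NormedRing L] [NormedAlgebra k L]

lemma mk_mul_mk (a b : E) (c d : L) : mk k a c * mk k b d = mk k (a * b) (c * d) :=
  Algebra.TensorProduct.tmul_mul_tmul a b c d

lemma norm_mk_le (a : E) (b : L) : ‖mk k a b‖ ≤ ‖a‖ * ‖b‖ :=
  csInf_le (bounds_bddBelow k _) ⟨by positivity, [(a, b)], by simp; rfl, by simp⟩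

variable (E L) in
/-- The inclusion `a ↦ a ⊗ 1`. -/
def inclLeft : E →+* CTensor k E L :=
  UniformSpace.Completion.coeRingHom.comp
    (Algebra.TensorProduct.includeLeftRingHom : E →+* E ⊗[k] L)

variable (E L) in
/-- The inclusion `b ↦ 1 ⊗ b`. -/
def inclRight : L →+* CTensor k E L :=
  UniformSpace.Completion.coeRingHom.comp
    ((Algebra.TensorProduct.includeRight : L →ₐ[k] E ⊗[k] L) : L →+* E ⊗[k] L)

lemma inclLeft_apply (a : E) : inclLeft k E L a = (mk k a (1 : L) : UTensor k E L) := rfl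

lemma inclRight_apply (b : L) : inclRight k E L b = (mk k (1 : E) b : UTensor k E L) := rfl

lemma inclRight_mul_inclLeft (a : E) (b : L) :
    inclRight k E L b * inclLeft k E L a = (mk k a b : UTensor k E L) := by
  rw [inclLeft_apply, inclRight_apply, ← UniformSpace.Completion.coe_mul, mk_mul_mk, one_mul,
    mul_one]

lemma inclLeft_mul_inclRight (a : E) (b : L) :
    inclLeft k E L a * inclRight k E L b = (mk k a b : UTensor k E L) := by
  rw [inclLeft_apply, inclRight_apply, ← UniformSpace.Completion.coe_mul, mk_mul_mk, one_mul,
    mul_one]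

lemma commute_inclLeft_inclRight (a : E) (b : L) :
    Commute (inclLeft k E L a) (inclRight k E L b) :=
  (inclLeft_mul_inclRight k a b).trans (inclRight_mul_inclLeft k a b).symm

/-- Factoring out the unit 1 ⊗ b leaves 1 - a ⊗ c, which a Neumann series inverts in the complete
ring. -/
lemma isUnit_inclLeft_sub_inclRight_of_norm_lt (a : E) {b c : L} (hbc : b * c = 1) (hcb : c * b = 1)
    (h : ‖a‖ * ‖c‖ < 1) : IsUnit (inclLeft k E L a - inclRight k E L b) := by
  have h1 : IsUnit (1 - inclRight k E L c * inclLeft k E L a) := by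
    refine isUnit_one_sub_of_norm_lt_one ?_
    rw [inclRight_mul_inclLeft, UniformSpace.Completion.norm_coe]
    exact (norm_mk_le k a c).trans_lt h
  have h2 : IsUnit (inclRight k E L b) := IsUnit.map _ ⟨⟨b, c, hbc, hcb⟩, rfl⟩
  have h3 : inclLeft k E L a - inclRight k E L b =
      -(inclRight k E L b * (1 - inclRight k E L c * inclLeft k E L a)) := by
    rw [mul_sub, ← mul_assoc, ← map_mul, hbc, map_one]
    simp
  rw [h3]
  exact (h2.mul h1).neg

/-- If the falling factorial of `a` is small compared with that of `b`, then `a ⊗ 1 - 1 ⊗ b` is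
invertible. -/
lemma isUnit_inclLeft_sub_inclRight_of_descProd (a : E) (b : L) (n : ℕ) {c : L}
    (hbc : descProd b n * c = 1) (hcb : c * descProd b n = 1) (h : ‖descProd a n‖ * ‖c‖ < 1) :
    IsUnit (inclLeft k E L a - inclRight k E L b) := by
  obtain ⟨q, hq, e⟩ := exists_sub_mul_eq_descProd_sub (commute_inclLeft_inclRight k a b) n
  have hu := isUnit_inclLeft_sub_inclRight_of_norm_lt k (descProd a n) hbc hcb h
  rw [map_descProd, map_descProd, ← e] at hu
  -- Each of two commuting factors of a unit is a unit.
  exact (hq.isUnit_mul_iff.1 hu).1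

end UTensor

/-! ### The invertibility criterion at x, and the residue field of a rational point. -/

namespace BerkovichLine

section

variable {k : Type*} [NontriviallyNormedField k] (x : BerkovichLine k)

/-- The evaluation `k[T] → ℋ(x)`. -/
def valHom : k[X] →+* x.H := UniformSpace.Completion.coeRingHom.comp x.toRes

lemma norm_val (f : k[X]) : ‖x.val f‖ = x.eval f := by
  rw [val, UniformSpace.Completion.norm_coe, norm_toRes]

lemma norm_descProd_val_X (n : ℕ) :
    ‖descProd (x.val X) n‖ = ∏ i ∈ Finset.range n, x.eval (X - C (i : k)) := by
  change ‖descProd (x.valHom X) n‖ = _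
  rw [← map_descProd]
  change ‖x.val _‖ = _
  rw [norm_val]
  induction n with
  | zero => simp [eval_one]
  | succ n ih =>
    rw [descProd_succ, eval_mul, ih, Finset.prod_range_succ, mul_comm, map_natCast]

/-- The norm of the field ℋ(x) is multiplicative, so the inverse of the falling factorial of T(x)
has exactly the reciprocal norm, as the Neumann criterion needs. -/
lemma notMem_berkovichSpectrum {E : Type*} [NormedRing E] [NormedAlgebra k E] (a : E) (n : ℕ)
    (h : ‖descProd a n‖ < ∏ i ∈ Finset.range n, x.eval (X - C (i : k))) :
    x ∉ berkovichSpectrum k a := by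
  rw [← norm_descProd_val_X] at h
  have hpos := (norm_nonneg _).trans_lt h
  have hne : descProd (x.val X) n ≠ 0 := norm_pos_iff.1 hpos
  have hu : IsUnit (UTensor.inclLeft k E x.H a - UTensor.inclRight k E x.H (x.val X)) := by
    refine UTensor.isUnit_inclLeft_sub_inclRight_of_descProd k a (x.val X) n
      (mul_inv_cancel₀ hne) (inv_mul_cancel₀ hne) ?_
    rw [norm_inv, ← div_eq_mul_inv, div_lt_one hpos]
    exact h
  rw [UTensor.inclLeft_apply, UTensor.inclRight_apply, ← UniformSpace.Completion.coe_sub] at hu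
  exact not_not.2 hu

lemma algebraMap_resField_ofPoint_surjective (b : k) :
    Function.Surjective (algebraMap k (ofPoint b).ResField) := by
  have hz : ∀ f : k[X], (ofPoint b).toRes f = algebraMap k _ (f.eval b) := by
    intro f
    rw [algebraMap_res, ← sub_eq_zero, ← map_sub, toRes_eq_zero, eval_ofPoint]
    simp
  intro z
  refine ⟨((ofPoint b).frac z).1.eval b / ((ofPoint b).frac z).2.eval b, ?_⟩
  conv_rhs => rw [frac_eq _ z]
  rw [map_div₀, hz, hz]

lemma val_X_ofPoint (b : k) : (ofPoint b).val X = algebraMap k (ofPoint b).H b := by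
  have h : (ofPoint b).toRes X = (ofPoint b).toRes (C b) := by
    rw [← sub_eq_zero, ← map_sub, toRes_eq_zero, eval_ofPoint]
    simp
  rw [val, h]
  rfl

/-- The image of k is dense, and closed because k is complete and embeds isometrically. -/
lemma algebraMap_H_ofPoint_bijective [CompleteSpace k] (b : k) :
    Function.Bijective (algebraMap k (ofPoint b).H) := by
  refine ⟨FaithfulSMul.algebraMap_injective _ _, ?_⟩
  have hi : Isometry (algebraMap k (ofPoint b).H) := algebraMap_isometry k _
  have hd : DenseRange (algebraMap k (ofPoint b).H) :=
    UniformSpace.Completion.denseRange_coe.comp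
      (algebraMap_resField_ofPoint_surjective b).denseRange
      (UniformSpace.Completion.continuous_coe _)
  rw [← Set.range_eq_univ, ← hi.isClosedEmbedding.isClosed_range.closure_eq]
  exact hd.closure_range

end

end BerkovichLine

/-- A rational point `b` outside the Berkovich spectrum of `a` is outside the usual spectrum. -/
lemma isUnit_sub_algebraMap_of_notMem_berkovichSpectrum {k E : Type*} [NontriviallyNormedField k]
    [CompleteSpace k] [NormedRing E] [NormedAlgebra k E] [CompleteSpace E] [IsUltrametricDist E]
    {a : E} {b : k} (h : BerkovichLine.ofPoint b ∉ berkovichSpectrum k a) :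
    IsUnit (a - algebraMap k E b) := by
  let e : k ≃ₐ[k] (BerkovichLine.ofPoint b).H :=
    AlgEquiv.ofBijective (Algebra.ofId k _) (BerkovichLine.algebraMap_H_ofPoint_bijective b)
  have he : ∀ c, ‖e.symm c‖ = ‖c‖ := fun c => by
    obtain ⟨c, rfl⟩ := e.surjective c
    rw [AlgEquiv.symm_apply_apply]
    exact (norm_algebraMap' _ c).symm
  -- Contraction y ⊗ c ↦ c y, with ℋ(b) identified with k. It is norm-decreasing because E is
  -- ultrametric, so it extends to the completed tensor product.
  let φ : E ⊗[k] (BerkovichLine.ofPoint b).H →ₐ[k] E :=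
    Algebra.TensorProduct.lift (AlgHom.id k E) ((Algebra.ofId k E).comp e.symm.toAlgHom)
      fun y c => (Algebra.commutes (e.symm c) y).symm
  have hφ : ∀ y c, φ (y ⊗ₜ c) = e.symm c • y := fun y c => by
    rw [Algebra.smul_def, Algebra.commutes]
    exact Algebra.TensorProduct.lift_tmul _ _ _ _ _
  have hb : ∀ z, ‖φ z‖ ≤ UTensor.tnorm k z := by
    intro z
    refine le_csInf (UTensor.bounds_nonempty k z) ?_
    rintro C ⟨hC, l, rfl, hlC⟩
    rw [map_list_sum, List.map_map]
    induction l with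
    | nil => simpa using hC
    | cons q l ih =>
      rw [List.map_cons, List.sum_cons]
      refine (IsUltrametricDist.norm_add_le_max _ _).trans (max_le ?_ ?_)
      · rw [Function.comp_apply, hφ, norm_smul, he, mul_comm]
        exact hlC q (List.mem_cons_self ..)
      · exact ih fun q' hq' => hlC q' (List.mem_cons_of_mem _ hq')
  let ψ : UTensor k E (BerkovichLine.ofPoint b).H →+* E := φ.toRingHom
  have hψ : Continuous ψ :=
    AddMonoidHomClass.continuous_of_bound ψ 1 fun z => by rw [one_mul]; exact hb z
  have hu := (not_not.1 h).map (UniformSpace.Completion.extensionHom ψ hψ)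
  rw [UniformSpace.Completion.extensionHom_coe, map_sub] at hu
  have h1 : ψ (UTensor.mk k a 1) = a := by
    change φ (a ⊗ₜ 1) = a
    rw [hφ, map_one, one_smul]
  have h2 : ψ (UTensor.mk k 1 ((BerkovichLine.ofPoint b).val X)) = algebraMap k E b := by
    change φ (1 ⊗ₜ _) = _
    rw [hφ, BerkovichLine.val_X_ofPoint, Algebra.algebraMap_eq_smul_one (A := E)]
    congr 1
    exact e.symm_apply_apply b
  rwa [h1, h2] at hu

lemma ContinuousLinearMap.isUltrametricDist {k V : Type*} [NontriviallyNormedField k]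
    [NormedAddCommGroup V] [NormedSpace k V] [IsUltrametricDist V] :
    IsUltrametricDist (V →L[k] V) :=
  IsUltrametricDist.isUltrametricDist_of_forall_norm_add_le_max_norm fun f g =>
    ContinuousLinearMap.opNorm_le_bound _ (le_max_of_le_left (norm_nonneg f)) fun v => by
      refine (IsUltrametricDist.norm_add_le_max _ _).trans (max_le ?_ ?_)
      · exact (f.le_opNorm v).trans (by gcongr; exact le_max_left _ _)
      · exact (g.le_opNorm v).trans (by gcongr; exact le_max_right _ _)

/-! ### Approximate eigenvectors of the Euler operator. -/

namespace BerkovichLine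

variable {k : Type*} [NontriviallyNormedField k] [IsUltrametricDist k]

instance isUltrametricDist_H (x : BerkovichLine k) : IsUltrametricDist x.H :=
  IsUltrametricDist.isUltrametricDist_of_forall_norm_add_le_max_norm fun a b => by
    induction a, b using UniformSpace.Completion.induction_on₂ with
    | hp => exact isClosed_le (by fun_prop) (by fun_prop)
    | ih a b =>
      rw [← UniformSpace.Completion.coe_add]
      simp only [UniformSpace.Completion.norm_coe]
      exact IsUltrametricDist.norm_add_le_max a b

/-- A limit of natural numbers is in the spectrum of `S d/dS`. -/
lemma not_isUnit_eulerOp_sub (r : ℝ) (hr : 0 < r) {b : k}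
    (hb : ∀ ε > 0, ∃ n : ℕ, ‖(n : k) - b‖ < ε) :
    ¬ IsUnit (eulerOp (k := k) r hr - algebraMap k _ b) := by
  intro h
  obtain ⟨T, hT⟩ := h.exists_left_inv
  -- An inverse T would satisfy |v| ≤ ‖T‖ |n - b| |v| for v = Sⁿ. This choice of n makes ‖T‖ |n - b|
  -- < 1; the added 1 covers T = 0.
  obtain ⟨n, hn⟩ := hb (‖T‖ + 1)⁻¹ (by positivity)
  set v := (gaussPoint (k := k) r hr).val (X ^ n) with hv
  have hv0 : 0 < ‖v‖ := norm_pos_iff.2 (val_X_pow_ne_zero r hr n)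
  have h1 : (eulerOp (k := k) r hr - algebraMap k _ b) v = ((n : k) - b) • v := by
    rw [sub_apply, eulerOp_pow, sub_smul, Algebra.algebraMap_eq_smul_one]
    rfl
  have h2 : T (((n : k) - b) • v) = v := by
    rw [← h1]
    exact congrArg (· v) hT
  have h3 : ‖v‖ ≤ ‖T‖ * (‖(n : k) - b‖ * ‖v‖) := by
    conv_lhs => rw [← h2]
    exact (T.le_opNorm _).trans (by rw [norm_smul])
  have h4 : ‖T‖ * ‖(n : k) - b‖ < 1 := by
    have h5 : ‖T‖ * ‖(n : k) - b‖ ≤ ‖T‖ * (‖T‖ + 1)⁻¹ := by gcongr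
    refine h5.trans_lt ?_
    rw [← div_eq_mul_inv, div_lt_one (by positivity)]
    linarith
  rw [← mul_assoc] at h3
  nlinarith

end BerkovichLine

end

theorem mainTheorem5 {k : Type*} [NontriviallyNormedField k] [CompleteSpace k]
    [IsUltrametricDist k] [IsAlgClosed k] [CharZero k] (p : ℕ) [Fact p.Prime]
    (hp : CharP (IsLocalRing.ResidueField
      (NormedField.valuation (K := k)).valuationSubring) p)
    (r : ℝ) (hr : 0 < r) :
    (∃! ι : ℤ_[p] →+* k, Continuous ι) ∧
    ∀ ι : ℤ_[p] →+* k, Continuous ι →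
      berkovichSpectrum k (BerkovichLine.eulerOp (k := k) r hr) =
        Set.range fun a : ℤ_[p] => BerkovichLine.ofPoint (ι a) := by
  have hp1 := norm_natCast_lt_one_of_charP_residueField p hp
  refine ⟨existsUnique_continuous_padicInt_ringHom p hp1, fun ι hι => Set.Subset.antisymm ?_ ?_⟩
  · intro x hx
    by_contra hne
    obtain ⟨n, hn⟩ := x.exists_norm_factorial_lt_prod_eval hp1 hι fun a h => hne ⟨a, h.symm⟩
    exact x.notMem_berkovichSpectrum _ n
      ((BerkovichLine.norm_descProd_eulerOp_le r hr n).trans_lt hn) hx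
  · rintro _ ⟨a, rfl⟩
    by_contra hne
    have := ContinuousLinearMap.isUltrametricDist (k := k)
      (V := (BerkovichLine.gaussPoint (k := k) r hr).H)
    have hu := isUnit_sub_algebraMap_of_notMem_berkovichSpectrum (b := ι a) hne
    refine BerkovichLine.not_isUnit_eulerOp_sub r hr (fun ε hε => ?_) hu
    -- Natural numbers are dense in ℤ_p and ι is continuous, so their images approach ι a.
    obtain ⟨n, hn⟩ := PadicInt.denseRange_natCast.exists_mem_open
      ((Metric.isOpen_ball (x := ι a) (ε := ε)).preimage hι) ⟨a, by simpa using hε⟩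
    refine ⟨n, ?_⟩
    rw [← dist_eq_norm]
    simpa using hn
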